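/- Let $\alpha\in(0,2)$, $\nu>0$ and $n\ge 1$ an integer. There is a probability density $p_{\alpha,\nu,n}$ on $\mathbb{R}^n$, continuous on $\mathbb{R}^n\setminus\{0\}$, with characteristic function $$\int_{\mathbb{R}^n}e^{i\mathbf{x}\cdot\boldsymbol{t}}\,p_{\alpha,\nu,n}(\mathbf{x})\,d^n\mathbf{x}=\frac{1}{(1+\Vert\boldsymbol{t}\Vert^{\alpha})^{\nu}},\qquad \boldsymbol{t}\in\mathbb{R}^n,$$ where $\Vert\cdot\Vert$ is the Euclidean norm. Every such density is radial on $\mathbb{R}^n\setminus\{0\}$, i.e. $p_{\alpha,\nu,n}(\mathbf{x})=q_{\alpha,\nu,n}(\Vert\mathbf{x}\Vert)$ for $\mathbf{x}\neq 0$, and for every $r>0$ and every $c$ with $0<c<\min\{\nu,1/\alpha\}$, $$q_{\alpha,\nu,n}(r)=\frac{r^{-n}}{\pi^{n/2}\,\Gamma(\nu)}\cdot\frac{1}{2\pi i}\int_{c-i\infty}^{c+i\infty}f_{\alpha,\nu,n}(w;r)\,dw,$$ where $$f_{\alpha,\nu,n}(w;r)=\Gamma(w)\,\Gamma(\nu-w)\left(\frac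 r2\right)^{\alpha w}\frac{\Gamma\left(\frac{n-\alpha w}{2}\right)}{\Gamma\left(\frac{\alpha w}{2}\right)},$$ and the integral along the vertical line $\operatorname{Re}w=c$ converges absolutely. -/

import Mathlib

noncomputable section

/-- The function `t ↦ 1 / (1 + ‖t‖ ^ α) ^ ν` on `ℝⁿ` (Euclidean norm). -/
def linnikCharFun (α ν : ℝ) (n : ℕ) (t : EuclideanSpace ℝ (Fin n)) : ℝ :=
  1 / (1 + ‖t‖ ^ α) ^ ν

/-- `p` is the probability density on `ℝⁿ` whose characteristic function is `linnikCharFun α ν n`.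
A density is determined by its characteristic function only almost everywhere; as usual, the version
that is continuous away from the origin (where `p` may be unbounded) is meant. Total mass one is
the Fourier identity at `t = 0`. -/
structure IsLinnikDensity (α ν : ℝ) (n : ℕ) (p : EuclideanSpace ℝ (Fin n) → ℝ) : Prop where
  nonneg : ∀ x, 0 ≤ p x
  integrable : MeasureTheory.Integrable p MeasureTheory.volume
  fourier : ∀ t : EuclideanSpace ℝ (Fin n),
    ∫ x, Complex.exp (Complex.I * ((inner ℝ x t : ℝ) : ℂ)) * ((p x : ℝ) : ℂ)
      = ((linnikCharFun α ν n t : ℝ) : ℂ)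
  continuousOn : ContinuousOn p {0}ᶜ

/-- `f(w; r) = Γ(w) Γ(ν - w) (r/2)^(α w) Γ((n - α w)/2) / Γ(α w/2)`. -/
def linnikKernel (α ν : ℝ) (n : ℕ) (r : ℝ) (w : ℂ) : ℂ :=
  Complex.Gamma w * Complex.Gamma ((ν : ℂ) - w) * ((r / 2 : ℝ) : ℂ) ^ ((α : ℂ) * w) *
    (Complex.Gamma (((n : ℂ) - (α : ℂ) * w) / 2) / Complex.Gamma ((α : ℂ) * w / 2))

/-- The contour integral of `f` from `c - i∞` to `c + i∞`, parametrized by `w = c + i y`,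
`dw = i dy`. -/
def verticalLineIntegral (f : ℂ → ℂ) (c : ℝ) : ℂ :=
  ∫ y : ℝ, f ((c : ℂ) + (y : ℂ) * Complex.I) * Complex.I

end

/-! Put `β = α / 2`, which lies in `(0, 1)`. The function `(1 + u ^ β) ^ (-ν)` is the Laplace
transform of a law `M` on `(0, ∞)`: that of `G ^ (1 / β) * X`, with `G` a Gamma(`ν`) variable and
`X` an independent one-sided `β`-stable variable (`exists_stable_law`, `exists_linnik_mixing`). At
`u = ‖t‖ ^ 2` this reads `(1 + ‖t‖ ^ α) ^ (-ν) = ∫ exp (-s ‖t‖ ^ 2) dM(s)`. Since `exp (-s ‖t‖ ^ 2)`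
is the Fourier transform of the heat kernel at time `s`, the `M`-mixture of heat kernels is a
density with the required characteristic function. It is radial, and continuous off the origin.
Injectivity of the characteristic function then makes every other such density agree with it off the
origin.

By Fubini, the Mellin transform of the radial profile at `z` is a Gaussian factor containing `Γ(z /
2)` times the moment of `M` of order `(z - n) / 2`. At `z = n - α w` that order is `-β w`, and the
moment is a quotient of Gamma functions, so the transform is the kernel `f` up to elementary
factors. Mellin inversion gives the formula (`heatMixture_eq_verticalLineIntegral`); it is justified
by the decay of `Γ(z / 2)` on vertical lines. -/

section LinnikTheory

open MeasureTheory Filter Topology Set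
open scoped NNReal ENNReal BoundedContinuousFunction

/-! ### Laplace transforms and weak limits on the half-line -/

/-- The bounded continuous function `x ↦ exp (-u x)` on `[0, ∞)`, for `u ≥ 0`. -/
noncomputable def expNegBCF (u : ℝ≥0) : ℝ≥0 →ᵇ ℝ :=
  BoundedContinuousFunction.ofNormedAddCommGroup (fun x : ℝ≥0 ↦ Real.exp (-(u * x)))
    (by fun_prop) 1 (fun x ↦ by
      rw [Real.norm_eq_abs, Real.abs_exp, Real.exp_le_one_iff, neg_nonpos]; positivity)

lemma expNegBCF_apply (u x : ℝ≥0) : expNegBCF u x = Real.exp (-(u * x)) := rfl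

/-- Markov's inequality: `1 - exp (-u x) ≥ 1 / 2` once `u x ≥ 1`, so the mass outside `[0, 1 / u]`
is at most `2 g u`, uniformly in `k`. -/
lemma isTightMeasureSet_of_laplace_le {μ : ℕ → Measure ℝ≥0} [∀ k, IsProbabilityMeasure (μ k)]
    {g : ℝ≥0 → ℝ} (hg : Tendsto g (𝓝[>] 0) (𝓝 0))
    (h : ∀ k u, 0 < u → 1 - ∫ x, expNegBCF u x ∂(μ k) ≤ g u) :
    IsTightMeasureSet (range μ) := by
  rw [isTightMeasureSet_iff_exists_isCompact_measure_compl_le]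
  intro ε hε
  obtain ⟨δ, hδ0, hδ⟩ := ENNReal.lt_iff_exists_nnreal_btwn.1 hε
  have hδ0' : (0 : ℝ) < δ := by exact_mod_cast hδ0
  obtain ⟨u, hgu, hu⟩ :=
    ((hg.eventually (gt_mem_nhds (half_pos hδ0'))).and self_mem_nhdsWithin).exists
  have hu : 0 < u := hu
  refine ⟨Icc 0 (1 / u), isCompact_Icc, ?_⟩
  rintro _ ⟨k, rfl⟩
  have hsub : (Icc 0 (1 / u))ᶜ ⊆ {x : ℝ≥0 | (1 / 2 : ℝ) ≤ 1 - expNegBCF u x} := by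
    intro x hx
    simp only [mem_compl_iff, mem_Icc, zero_le, true_and, not_le, div_lt_iff₀ hu] at hx
    have h1 : (1 : ℝ) ≤ u * x := by rw [mul_comm]; exact_mod_cast hx.le
    have h2 : Real.exp (-(u * x)) ≤ Real.exp (-1) := Real.exp_le_exp.2 (by linarith)
    have h3 := Real.exp_neg_one_lt_half
    simp only [mem_ofPred_eq, expNegBCF_apply]
    linarith
  have hint : Integrable (fun x ↦ expNegBCF u x) (μ k) := (expNegBCF u).integrable _
  have hmk := mul_meas_ge_le_integral_of_nonneg (μ := μ k) (f := fun x ↦ 1 - expNegBCF u x)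
    (ae_of_all _ fun x ↦ by
      have : Real.exp (-(u * x)) ≤ 1 := by
        rw [Real.exp_le_one_iff, neg_nonpos]; positivity
      simpa [expNegBCF_apply] using this) ((integrable_const 1).sub hint) (1 / 2)
  rw [integral_sub (integrable_const 1) hint, integral_const, probReal_univ, one_smul] at hmk
  have hk := h k u hu
  have hreal : (μ k).real (Icc 0 (1 / u))ᶜ ≤ δ := by
    have := measureReal_mono hsub (measure_ne_top (μ k) _)
    linarith
  refine le_trans ?_ hδ.le
  rw [← ENNReal.ofReal_coe_nnreal]
  exact (ENNReal.le_ofReal_iff_toReal_le (measure_ne_top _ _) δ.2).2 hreal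

/-- The continuity theorem for Laplace transforms of probability measures on `[0, ∞)`. -/
lemma exists_measure_of_tendsto_laplace {μ : ℕ → Measure ℝ≥0}
    [hμ : ∀ k, IsProbabilityMeasure (μ k)]
    {g L : ℝ≥0 → ℝ} (hg : Tendsto g (𝓝[>] 0) (𝓝 0))
    (h : ∀ k u, 0 < u → 1 - ∫ x, expNegBCF u x ∂(μ k) ≤ g u)
    (hL : ∀ u, 0 < u → Tendsto (fun k ↦ ∫ x, expNegBCF u x ∂(μ k)) atTop (𝓝 (L u))) :
    ∃ P : Measure ℝ≥0, IsProbabilityMeasure P ∧ ∀ u, 0 < u → ∫ x, expNegBCF u x ∂P = L u := by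
  let ν : ℕ → ProbabilityMeasure ℝ≥0 := fun k ↦ ⟨μ k, hμ k⟩
  have htight : IsTightMeasureSet {((m : ProbabilityMeasure ℝ≥0) : Measure ℝ≥0) | m ∈ range ν} := by
    refine (isTightMeasureSet_of_laplace_le hg h).subset ?_
    rintro _ ⟨_, ⟨k, rfl⟩, rfl⟩
    exact ⟨k, rfl⟩
  have hcomp := isCompact_closure_of_isTightMeasureSet htight
  -- By Prokhorov's theorem the laws have a weak limit along a nonprincipal ultrafilter, which
  -- replaces the extraction of a subsequence.
  obtain ⟨P, -, hP⟩ := hcomp.ultrafilter_le_nhds ((hyperfilter ℕ).map ν)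
    (.trans (by simp) (monotone_principal (subset_closure (s := range ν))))
  have hP : Tendsto ν (hyperfilter ℕ) (𝓝 P) := hP
  rw [ProbabilityMeasure.tendsto_iff_forall_integral_tendsto] at hP
  refine ⟨P, inferInstance, fun u hu ↦ tendsto_nhds_unique (hP (expNegBCF u)) ?_⟩
  exact (hL u hu).mono_left Nat.hyperfilter_le_atTop

/-! ### Construction of the one-sided stable law -/

section Stable

variable {b : ℝ}

lemma one_sub_expNegBCF_nonneg (u x : ℝ≥0) : 0 ≤ 1 - expNegBCF u x := by
  have : Real.exp (-(u * x)) ≤ 1 := by rw [Real.exp_le_one_iff, neg_nonpos]; positivity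
  simpa [expNegBCF_apply] using this

lemma one_sub_expNegBCF_le (u x : ℝ≥0) : 1 - expNegBCF u x ≤ u * x := by
  have := Real.add_one_le_exp (-(u * x : ℝ))
  rw [expNegBCF_apply]; linarith

lemma measurable_one_sub_expNegBCF (u : ℝ≥0) (b : ℝ) :
    Measurable fun v : ℝ ↦ 1 - expNegBCF u (Real.toNNReal (v ^ (-b))) := by
  simp only [expNegBCF_apply]; fun_prop

/-- The integrand is at most `1` near the origin and at most `u * v ^ (-b)` at infinity, where `b >
1`. -/
lemma integrableOn_one_sub_expNegBCF (hb : 1 < b) (u : ℝ≥0) :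
    IntegrableOn (fun v : ℝ ↦ 1 - expNegBCF u (Real.toNNReal (v ^ (-b)))) (Ioi 0) := by
  rw [← Ioc_union_Ioi_eq_Ioi zero_le_one]
  refine IntegrableOn.union ?_ ?_
  · refine Measure.integrableOn_of_bounded (M := 1) (by simp)
      (measurable_one_sub_expNegBCF u b).aestronglyMeasurable (ae_of_all _ fun v ↦ ?_)
    rw [Real.norm_eq_abs, abs_of_nonneg (one_sub_expNegBCF_nonneg _ _), expNegBCF_apply]
    linarith [Real.exp_pos (-(u * (Real.toNNReal (v ^ (-b)) : ℝ)))]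
  · refine Integrable.mono' ((integrableOn_Ioi_rpow_of_lt (neg_lt_neg hb) one_pos).const_mul u)
      (measurable_one_sub_expNegBCF u b).aestronglyMeasurable ?_
    refine (ae_restrict_iff' measurableSet_Ioi).2 (ae_of_all _ fun v hv ↦ ?_)
    have hv : (1 : ℝ) < v := hv
    rw [Real.norm_eq_abs, abs_of_nonneg (one_sub_expNegBCF_nonneg _ _)]
    refine (one_sub_expNegBCF_le _ _).trans_eq ?_
    rw [Real.coe_toNNReal _ (by positivity)]

/-- Scaling `v` by `u ^ (1 / b)` removes `u` from the integrand; this is the source of the exponent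
`β = 1 / b`. -/
lemma setIntegral_one_sub_expNegBCF (hb : 1 < b) {u : ℝ≥0} (hu : 0 < u) :
    ∫ v in Ioi (0 : ℝ), (1 - expNegBCF u (Real.toNNReal (v ^ (-b)))) =
      (u : ℝ) ^ (1 / b) * ∫ v in Ioi (0 : ℝ), (1 - expNegBCF 1 (Real.toNNReal (v ^ (-b)))) := by
  have hu' : (0 : ℝ) < u := hu
  have hb0 : b ≠ 0 := by positivity
  have h := integral_comp_mul_left_Ioi
    (fun v : ℝ ↦ 1 - expNegBCF u (Real.toNNReal (v ^ (-b)))) 0 (Real.rpow_pos_of_pos hu' (1 / b))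
  rw [mul_zero, smul_eq_mul] at h
  rw [eq_inv_mul_iff_mul_eq₀ (by positivity)] at h
  rw [← h]
  congr 1
  refine setIntegral_congr_fun measurableSet_Ioi fun v hv ↦ ?_
  have hv : (0 : ℝ) < v := hv
  simp only [expNegBCF_apply]
  rw [Real.coe_toNNReal _ (by positivity), Real.coe_toNNReal _ (by positivity),
    Real.mul_rpow (by positivity) hv.le, ← Real.rpow_mul hu'.le,
    show 1 / b * -b = -1 by field_simp, Real.rpow_neg_one, mul_inv_cancel_left₀ hu'.ne']
  simp

lemma setIntegral_one_sub_expNegBCF_pos (hb : 1 < b) :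
    0 < ∫ v in Ioi (0 : ℝ), (1 - expNegBCF 1 (Real.toNNReal (v ^ (-b)))) := by
  rw [setIntegral_pos_iff_support_of_nonneg_ae
    (ae_of_all _ fun v ↦ one_sub_expNegBCF_nonneg _ _) (integrableOn_one_sub_expNegBCF hb 1)]
  refine lt_of_lt_of_le (b := volume (Ioi (0 : ℝ))) (by simp) (measure_mono fun v hv ↦ ⟨?_, hv⟩)
  have hv : (0 : ℝ) < v := hv
  have : (0 : ℝ) < v ^ (-b) := by positivity
  rw [Function.mem_support, expNegBCF_apply, Real.coe_toNNReal _ this.le]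
  refine (sub_pos.2 (Real.exp_lt_one_iff.2 ?_)).ne'
  simpa using this

/-- The uniform probability measure on `(0, n]`. -/
noncomputable def uniformIoc (n : ℕ) : Measure ℝ := (n : ℝ≥0∞)⁻¹ • volume.restrict (Ioc 0 (n : ℝ))

instance (n : ℕ) [NeZero n] : IsProbabilityMeasure (uniformIoc n) where
  measure_univ := by
    simp [uniformIoc, ENNReal.inv_mul_cancel (a := n) (by simp [NeZero.ne n]) (by simp)]

/-- The law of `∑ vᵢ ^ (-b)` for `n` independent variables `vᵢ` uniform on `(0, n]`. -/
noncomputable def stableApprox (b : ℝ) (n : ℕ) : Measure ℝ≥0 :=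
  (Measure.pi fun _ : Fin n ↦ uniformIoc n).map fun v ↦ ∑ i, Real.toNNReal (v i ^ (-b))

instance (b : ℝ) (n : ℕ) [NeZero n] : IsProbabilityMeasure (stableApprox b n) :=
  Measure.isProbabilityMeasure_map (Measurable.aemeasurable (by fun_prop))

/-- Independence turns the exponential of the sum into a product of `n` equal factors, each `1`
minus an average over `(0, n]`. -/
lemma integral_expNegBCF_stableApprox (hb : 1 < b) (n : ℕ) [NeZero n] (u : ℝ≥0) :
    ∫ x, expNegBCF u x ∂(stableApprox b n) =
      (1 + -(∫ v in Ioc 0 (n : ℝ), (1 - expNegBCF u (Real.toNNReal (v ^ (-b))))) / n) ^ n := by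
  rw [stableApprox, integral_map (Measurable.aemeasurable (by fun_prop)) (expNegBCF u).continuous.aestronglyMeasurable]
  have h (v : Fin n → ℝ) : expNegBCF u (∑ i, Real.toNNReal (v i ^ (-b))) =
      ∏ i, expNegBCF u (Real.toNNReal (v i ^ (-b))) := by
    simp [expNegBCF_apply, Finset.mul_sum, ← Real.exp_sum]
  simp_rw [h]
  rw [integral_fintype_prod_eq_prod (fun _ v ↦ expNegBCF u (Real.toNNReal (v ^ (-b)))),
    Finset.prod_const, Finset.card_univ, Fintype.card_fin]
  congr 1
  have hint := integrableOn_one_sub_expNegBCF hb u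
  have hint' : Integrable (fun v : ℝ ↦ 1 - expNegBCF u (Real.toNNReal (v ^ (-b))))
      (uniformIoc n) :=
    (hint.mono_set Ioc_subset_Ioi_self).smul_measure (by simp [NeZero.ne n])
  have := integral_sub (integrable_const (1 : ℝ)) hint'
  simp only [sub_sub_cancel, integral_const, probReal_univ, one_smul] at this
  rw [this, uniformIoc, integral_smul_measure]
  simp
  ring

lemma setIntegral_Ioc_one_sub_le (hb : 1 < b) (u : ℝ≥0) (n : ℕ) :
    ∫ v in Ioc 0 (n : ℝ), (1 - expNegBCF u (Real.toNNReal (v ^ (-b)))) ≤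
      ∫ v in Ioi (0 : ℝ), (1 - expNegBCF u (Real.toNNReal (v ^ (-b)))) :=
  setIntegral_mono_set (integrableOn_one_sub_expNegBCF hb u)
    (ae_of_all _ fun _ ↦ one_sub_expNegBCF_nonneg _ _) (ae_of_all _ Ioc_subset_Ioi_self)

lemma tendsto_integral_expNegBCF_stableApprox (hb : 1 < b) (u : ℝ≥0) :
    Tendsto (fun k : ℕ ↦ ∫ x, expNegBCF u x ∂(stableApprox b (k + 1))) atTop
      (𝓝 (Real.exp (-∫ v in Ioi (0 : ℝ), (1 - expNegBCF u (Real.toNNReal (v ^ (-b))))))) := by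
  simp_rw [integral_expNegBCF_stableApprox hb]
  refine (tendsto_add_atTop_iff_nat (f := fun n : ℕ ↦ (1 + -(∫ v in Ioc 0 (n : ℝ),
    (1 - expNegBCF u (Real.toNNReal (v ^ (-b))))) / n) ^ n) 1).2 ?_
  refine Real.tendsto_one_add_pow_exp_of_tendsto ?_
  have h := (intervalIntegral_tendsto_integral_Ioi 0 (integrableOn_one_sub_expNegBCF hb u)
    tendsto_natCast_atTop_atTop).neg
  refine h.congr' ?_
  filter_upwards [eventually_ne_atTop 0] with n hn
  have : (n : ℝ) ≠ 0 := by exact_mod_cast hn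
  rw [intervalIntegral.integral_of_le (by positivity)]
  field_simp

/-- The one-sided stable law of index `β ∈ (0, 1)`. -/
lemma exists_stable_law {β : ℝ} (hβ : 0 < β) (hβ1 : β < 1) :
    ∃ P : Measure ℝ, IsProbabilityMeasure P ∧ (∀ᵐ x ∂P, 0 < x) ∧
      ∀ u : ℝ, 0 < u → ∫ x, Real.exp (-(u * x)) ∂P = Real.exp (-u ^ β) := by
  have hb : 1 < 1 / β := (one_lt_div hβ).2 hβ1
  set C := ∫ v in Ioi (0 : ℝ), (1 - expNegBCF 1 (Real.toNNReal (v ^ (-(1 / β))))) with hC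
  have hCpos : 0 < C := setIntegral_one_sub_expNegBCF_pos hb
  obtain ⟨Q, hQ, hQL⟩ : ∃ Q : Measure ℝ≥0, IsProbabilityMeasure Q ∧
      ∀ u, 0 < u → ∫ x, expNegBCF u x ∂Q = Real.exp (-((u : ℝ) ^ β * C)) := by
    -- The modulus `u ^ β * C` is the limiting exponent itself; Bernoulli's inequality shows that it
    -- already works for every approximant.
    refine exists_measure_of_tendsto_laplace
      (μ := fun k ↦ stableApprox (1 / β) (k + 1)) (g := fun u ↦ (u : ℝ) ^ β * C) ?_ ?_ ?_
    · have : Tendsto (fun u : ℝ≥0 ↦ (u : ℝ) ^ β * C) (𝓝 0) (𝓝 (((0 : ℝ≥0) : ℝ) ^ β * C)) :=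
        Continuous.tendsto (((NNReal.continuous_coe).rpow_const fun _ ↦ Or.inr hβ.le).mul_const C) 0
      rw [NNReal.coe_zero, Real.zero_rpow hβ.ne', zero_mul] at this
      exact this.mono_left nhdsWithin_le_nhds
    · intro k u hu
      have h1 := setIntegral_one_sub_expNegBCF hb hu
      rw [one_div_one_div, ← hC] at h1
      have h2 := setIntegral_Ioc_one_sub_le hb u (k + 1)
      rw [integral_expNegBCF_stableApprox hb]
      rw [h1] at h2
      set J := ∫ v in Ioc 0 ((k + 1 : ℕ) : ℝ), (1 - expNegBCF u (Real.toNNReal (v ^ (-(1 / β)))))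
      -- Needed for Bernoulli's inequality, which asks that `-J / (k + 1)` be at least `-2`.
      have hJ : J ≤ (k + 1 : ℕ) := by
        have := setIntegral_mono_on (μ := volume) (s := Ioc 0 ((k + 1 : ℕ) : ℝ))
          ((integrableOn_one_sub_expNegBCF hb u).mono_set Ioc_subset_Ioi_self)
          (g := fun _ ↦ (1 : ℝ)) (by simp) measurableSet_Ioc
          (fun v _ ↦ by rw [expNegBCF_apply]; linarith [Real.exp_pos (-(u *
            (Real.toNNReal (v ^ (-(1 / β))) : ℝ)))])
        exact this.trans_eq (by simp; positivity)
      have hk : (0 : ℝ) < (k + 1 : ℕ) := by positivity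
      have h3 := one_add_mul_le_pow (a := -J / (k + 1 : ℕ)) (by
        rw [neg_div]
        have : J / (k + 1 : ℕ) ≤ 1 := (div_le_one hk).2 hJ
        linarith) (k + 1)
      rw [mul_div_cancel₀ _ hk.ne'] at h3
      linarith
    · intro u hu
      have := tendsto_integral_expNegBCF_stableApprox hb u
      rwa [setIntegral_one_sub_expNegBCF hb hu, one_div_one_div, ← hC] at this
  -- Dilating by `D` multiplies the exponent by `D ^ β = C⁻¹` and so normalizes the constant to `1`.
  set D := C ^ (-(1 / β)) with hD
  have hDpos : 0 < D := Real.rpow_pos_of_pos hCpos _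
  have hmeas : Measurable fun x : ℝ≥0 ↦ D * (x : ℝ) := by fun_prop
  have hlap (u : ℝ) (hu : 0 < u) :
      ∫ x, Real.exp (-(u * x)) ∂(Q.map fun x : ℝ≥0 ↦ D * (x : ℝ)) = Real.exp (-u ^ β) := by
    rw [integral_map hmeas.aemeasurable
      (Continuous.aestronglyMeasurable (by fun_prop))]
    have h := hQL (Real.toNNReal (u * D)) (by positivity)
    simp only [expNegBCF_apply, Real.coe_toNNReal _ (mul_pos hu hDpos).le] at h
    rw [Real.mul_rpow hu.le hDpos.le, hD, ← Real.rpow_mul hCpos.le,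
      show -(1 / β) * β = -1 by field_simp, Real.rpow_neg_one, inv_mul_cancel_right₀ hCpos.ne']
      at h
    rw [← h]
    simp only [mul_assoc, hD]
  have hprob : IsProbabilityMeasure (Q.map fun x : ℝ≥0 ↦ D * (x : ℝ)) :=
    Measure.isProbabilityMeasure_map hmeas.aemeasurable
  refine ⟨Q.map fun x : ℝ≥0 ↦ D * (x : ℝ), hprob, ?_, hlap⟩
  set P := Q.map fun x : ℝ≥0 ↦ D * (x : ℝ)
  have hnn : ∀ᵐ x ∂P, 0 ≤ x := by
    rw [ae_map_iff hmeas.aemeasurable measurableSet_Ici]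
    exact ae_of_all _ fun x ↦ by positivity
  -- An atom at `0` contributes its full mass to every Laplace integral, and these tend to `0` as `u
  -- → ∞`.
  have hzero : P.real {0} ≤ 0 := by
    refine ge_of_tendsto (f := fun u : ℝ ↦ Real.exp (-u ^ β)) (x := atTop) ?_ ?_
    · exact Real.tendsto_exp_neg_atTop_nhds_zero.comp (tendsto_rpow_atTop hβ)
    · filter_upwards [eventually_gt_atTop 0] with u hu
      rw [← hlap u hu]
      have hint : Integrable (fun x ↦ Real.exp (-(u * x))) P := by
        refine Integrable.mono' (integrable_const 1)
          (Continuous.aestronglyMeasurable (by fun_prop)) ?_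
        filter_upwards [hnn] with x hx
        rw [Real.norm_eq_abs, Real.abs_exp, Real.exp_le_one_iff, neg_nonpos]
        positivity
      have h1 := setIntegral_le_integral (s := {0}) hint (ae_of_all _ fun x ↦ (Real.exp_pos _).le)
      simpa [measureReal_def] using! h1
  have hz : P {0} = 0 := (measureReal_eq_zero_iff).1 (le_antisymm hzero measureReal_nonneg)
  have hne : ∀ᵐ x ∂P, x ≠ 0 := by
    rw [ae_iff]; simpa using! hz
  filter_upwards [hnn, hne] with x hx hx'
  exact lt_of_le_of_ne hx hx'.symm

end Stable

/-! ### Complex moments of the Gamma, stable and mixing laws -/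

section Moments

open ProbabilityTheory

lemma measurable_gammaPDF (a : ℝ) : Measurable (gammaPDF a 1) :=
  (measurable_gammaPDFReal a 1).ennreal_ofReal

lemma integral_gammaMeasure {a : ℝ} (ha : 0 < a) {E : Type*} [NormedAddCommGroup E]
    [NormedSpace ℝ E] (f : ℝ → E) :
    ∫ x, f x ∂(gammaMeasure a 1) =
      ∫ x in Ioi (0 : ℝ), (x ^ (a - 1) * Real.exp (-x) / Real.Gamma a) • f x := by
  have hΓ := Real.Gamma_pos_of_pos ha
  rw [gammaMeasure, integral_withDensity_eq_integral_toReal_smul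
    (measurable_gammaPDF a) (ae_of_all _ fun x ↦ ENNReal.ofReal_lt_top),
    ← integral_Ici_eq_integral_Ioi, ← integral_indicator measurableSet_Ici]
  congr 1 with x
  by_cases hx : 0 ≤ x
  · rw [indicator_of_mem (show x ∈ Ici 0 from hx), gammaPDF_of_nonneg hx, ENNReal.toReal_ofReal]
    · rw [Real.one_rpow, one_mul]; congr 1; ring
    · rw [Real.one_rpow]; positivity
  · rw [indicator_of_notMem (by simpa using hx), gammaPDF_of_neg (not_le.1 hx)]; simp

lemma ae_pos_gammaMeasure (a : ℝ) : ∀ᵐ x ∂(gammaMeasure a 1), 0 < x := by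
  rw [gammaMeasure, ae_withDensity_iff (measurable_gammaPDF a)]
  filter_upwards [compl_mem_ae_iff.2 (measure_singleton (0 : ℝ))] with x hx h
  by_contra h'
  exact h (gammaPDF_of_neg (lt_of_le_of_ne (not_lt.1 h') hx))

lemma integral_exp_neg_mul_gammaMeasure {a r : ℝ} (ha : 0 < a) (hr : 0 ≤ r) :
    ∫ x, Real.exp (-(r * x)) ∂(gammaMeasure a 1) = 1 / (1 + r) ^ a := by
  have hΓ := Real.Gamma_pos_of_pos ha
  have h := Real.integral_rpow_mul_exp_neg_mul_Ioi ha (show 0 < 1 + r by positivity)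
  rw [integral_gammaMeasure ha]
  calc _ = ∫ x in Ioi (0 : ℝ), x ^ (a - 1) * Real.exp (-((1 + r) * x)) / Real.Gamma a := by
        refine integral_congr_ae (ae_of_all _ fun x ↦ ?_)
        simp only [smul_eq_mul]
        rw [show -((1 + r) * x) = -x + -(r * x) by ring, Real.exp_add]
        ring
    _ = _ := by
        rw [integral_div, h, mul_div_cancel_right₀ _ hΓ.ne', Real.div_rpow zero_le_one
          (by positivity), Real.one_rpow]

lemma integral_cpow_neg_gammaMeasure {a : ℝ} (ha : 0 < a) {w : ℂ} (hw : w.re < a) :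
    ∫ x : ℝ, (x : ℂ) ^ (-w) ∂(gammaMeasure a 1) = Complex.Gamma (a - w) / Complex.Gamma a := by
  rw [integral_gammaMeasure ha, Complex.Gamma_eq_integral (s := a - w) (by simpa using hw),
    Complex.GammaIntegral, ← integral_div]
  refine setIntegral_congr_fun measurableSet_Ioi fun x hx ↦ ?_
  have hx : (0 : ℝ) < x := hx
  have hx' : (x : ℂ) ≠ 0 := by exact_mod_cast hx.ne'
  simp only [Complex.real_smul]
  rw [show (a : ℂ) - w - 1 = (a - 1) + -w by ring, Complex.cpow_add _ _ hx', Complex.Gamma_ofReal]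
  push_cast
  rw [Complex.ofReal_cpow hx.le]
  push_cast
  ring

lemma integrable_cpow_neg_gammaMeasure {a : ℝ} (ha : 0 < a) {w : ℂ} (hw : w.re < a) :
    Integrable (fun x : ℝ ↦ (x : ℂ) ^ (-w)) (gammaMeasure a 1) := by
  -- A Bochner integral that is nonzero forces integrability, so the explicit value suffices.
  refine Integrable.of_integral_ne_zero ?_
  rw [integral_cpow_neg_gammaMeasure ha hw]
  exact div_ne_zero (Complex.Gamma_ne_zero_of_re_pos (by simpa using hw))
    (Complex.Gamma_ne_zero_of_re_pos (by simpa using ha))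

lemma mellin_exp_neg_rpow {β : ℝ} (hβ : 0 < β) {z : ℂ} (hz : 0 < z.re) :
    mellin (fun u : ℝ ↦ (Real.exp (-u ^ β) : ℂ)) z = Complex.Gamma (z / β) / β := by
  have h := mellin_comp_rpow (fun u : ℝ ↦ (Real.exp (-u) : ℂ)) z β
  rw [h, abs_of_pos hβ, Complex.Gamma_eq_integral (by
    rw [Complex.div_ofReal_re]; positivity), Complex.GammaIntegral, mellin, Complex.real_smul]
  push_cast
  refine (inv_mul_eq_div _ _).trans ?_
  congr 1
  refine integral_congr_ae (ae_of_all _ fun x ↦ ?_)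
  simp [mul_comm]

lemma integrable_exp_neg_mul {P : Measure ℝ} [IsFiniteMeasure P] (hP : ∀ᵐ x ∂P, 0 < x) {u : ℝ}
    (hu : 0 ≤ u) : Integrable (fun x ↦ Real.exp (-(u * x))) P := by
  refine Integrable.mono' (integrable_const 1) (Continuous.aestronglyMeasurable (by fun_prop)) ?_
  filter_upwards [hP] with x hx
  rw [Real.norm_eq_abs, Real.abs_exp, Real.exp_le_one_iff, neg_nonpos]
  positivity

variable {P : Measure ℝ} [IsProbabilityMeasure P] {β : ℝ}

/-- Licenses Fubini for the stable moments: integrating the norm over `x` first leaves `u ^ (z.re -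
1) * exp (-u ^ β)`, a convergent Gamma-type integral. -/
lemma integrable_cpow_mul_exp_prod (hβ : 0 < β) (hP : ∀ᵐ x ∂P, 0 < x)
    (hL : ∀ u : ℝ, 0 < u → ∫ x, Real.exp (-(u * x)) ∂P = Real.exp (-u ^ β))
    {z : ℂ} (hz : 0 < z.re) :
    Integrable (fun p : ℝ × ℝ ↦ (p.1 : ℂ) ^ (z - 1) * Complex.exp (-(p.2 * p.1 : ℂ)))
      ((volume.restrict (Ioi 0)).prod P) := by
  rw [integrable_prod_iff (Measurable.aestronglyMeasurable (by fun_prop))]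
  have hnorm (u : ℝ) (hu : 0 < u) (x : ℝ) :
      ‖(u : ℂ) ^ (z - 1) * Complex.exp (-(x * u : ℂ))‖ =
        u ^ (z.re - 1) * Real.exp (-(u * x)) := by
    rw [norm_mul, Complex.norm_cpow_eq_rpow_re_of_pos hu, Complex.norm_exp]
    simp [mul_comm]
  constructor
  · refine (ae_restrict_iff' measurableSet_Ioi).2 (ae_of_all _ fun u hu ↦ ?_)
    have hu : (0 : ℝ) < u := hu
    refine Integrable.mono' ((integrable_exp_neg_mul hP hu.le).const_mul (u ^ (z.re - 1)))
      (Measurable.aestronglyMeasurable (by fun_prop)) (ae_of_all _ fun x ↦ (hnorm u hu x).le)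
  · have : IntegrableOn (fun u : ℝ ↦ u ^ (z.re - 1) * Real.exp (-u ^ β)) (Ioi 0) := by
      refine Integrable.of_integral_ne_zero ?_
      rw [integral_rpow_mul_exp_neg_rpow hβ (by linarith)]
      have : 0 < Real.Gamma ((z.re - 1 + 1) / β) :=
        Real.Gamma_pos_of_pos (div_pos (by linarith) hβ)
      positivity
    refine this.congr_fun (fun u hu ↦ ?_) measurableSet_Ioi
    have hu : (0 : ℝ) < u := hu
    simp only [hnorm u hu]
    rw [integral_const_mul, hL u hu]

lemma integral_Ioi_cpow_mul_exp {x : ℝ} (hx : 0 < x) {z : ℂ} (hz : 0 < z.re) :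
    ∫ u in Ioi (0 : ℝ), (u : ℂ) ^ (z - 1) * Complex.exp (-(x * u : ℂ)) =
      (x : ℂ) ^ (-z) * Complex.Gamma z := by
  rw [Complex.integral_cpow_mul_exp_neg_mul_Ioi hz hx, one_div, Complex.inv_cpow _ _ (by
    rw [Complex.arg_ofReal_of_nonneg hx.le]; exact Real.pi_pos.ne), Complex.cpow_neg]

lemma integrable_cpow_neg_stable (hβ : 0 < β) (hP : ∀ᵐ x ∂P, 0 < x)
    (hL : ∀ u : ℝ, 0 < u → ∫ x, Real.exp (-(u * x)) ∂P = Real.exp (-u ^ β))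
    {z : ℂ} (hz : 0 < z.re) : Integrable (fun x : ℝ ↦ (x : ℂ) ^ (-z)) P := by
  have h := (integrable_cpow_mul_exp_prod hβ hP hL hz).integral_prod_right.mul_const
    (Complex.Gamma z)⁻¹
  refine h.congr ?_
  filter_upwards [hP] with x hx
  rw [integral_Ioi_cpow_mul_exp hx hz,
    mul_inv_cancel_right₀ (Complex.Gamma_ne_zero_of_re_pos hz)]

/-- Write `x ^ (-z) * Γ(z)` as `∫ u ^ (z - 1) exp (-x u) du` and swap the integrals: the result is
the Mellin transform of `exp (-u ^ β)`. -/
lemma integral_cpow_neg_stable (hβ : 0 < β) (hP : ∀ᵐ x ∂P, 0 < x)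
    (hL : ∀ u : ℝ, 0 < u → ∫ x, Real.exp (-(u * x)) ∂P = Real.exp (-u ^ β))
    {z : ℂ} (hz : 0 < z.re) :
    ∫ x : ℝ, (x : ℂ) ^ (-z) ∂P = Complex.Gamma (z / β) / (β * Complex.Gamma z) := by
  have h := integral_integral_swap
    (f := fun u x : ℝ ↦ (u : ℂ) ^ (z - 1) * Complex.exp (-(x * u : ℂ)))
    (integrable_cpow_mul_exp_prod hβ hP hL hz)
  rw [integral_congr_ae (μ := P) (g := fun x : ℝ ↦ (x : ℂ) ^ (-z) * Complex.Gamma z) (by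
    filter_upwards [hP] with x hx using integral_Ioi_cpow_mul_exp hx hz), integral_mul_const,
    setIntegral_congr_fun (g := fun u : ℝ ↦ (u : ℂ) ^ (z - 1) • (Real.exp (-u ^ β) : ℂ))
      measurableSet_Ioi, ← mellin, mellin_exp_neg_rpow hβ hz] at h
  · rw [eq_div_of_mul_eq (Complex.Gamma_ne_zero_of_re_pos hz) h.symm, div_div]
  · intro u hu
    have hu : (0 : ℝ) < u := hu
    simp only [smul_eq_mul]
    rw [integral_const_mul, ← hL u hu, ← integral_complex_ofReal]
    simp [mul_comm]

/-- The one-sided law with Laplace transform `(1 + u ^ β) ^ (-ν)`, and its moments of negative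
order. -/
lemma exists_linnik_mixing {ν : ℝ} (hβ : 0 < β) (hβ1 : β < 1) (hν : 0 < ν) :
    ∃ M : Measure ℝ, IsProbabilityMeasure M ∧ (∀ᵐ s ∂M, 0 < s) ∧
      (∀ u : ℝ, 0 < u → ∫ s, Real.exp (-(u * s)) ∂M = 1 / (1 + u ^ β) ^ ν) ∧
      ∀ w : ℂ, 0 < w.re → w.re < ν →
        Integrable (fun s : ℝ ↦ (s : ℂ) ^ (-(β * w))) M ∧
        ∫ s : ℝ, (s : ℂ) ^ (-(β * w)) ∂M =
          Complex.Gamma w * Complex.Gamma (ν - w) /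
            (Complex.Gamma ν * (β * Complex.Gamma (β * w))) := by
  obtain ⟨P, hPp, hP, hL⟩ := exists_stable_law hβ hβ1
  have hG := ae_pos_gammaMeasure ν
  have hGp : IsProbabilityMeasure (gammaMeasure ν 1) :=
    isProbabilityMeasure_gammaMeasure hν one_pos
  have hm : Measurable fun p : ℝ × ℝ ↦ p.1 ^ (1 / β) * p.2 := by fun_prop
  have hpos : ∀ᵐ p ∂((gammaMeasure ν 1).prod P), 0 < p.1 ∧ 0 < p.2 :=
    (Measure.quasiMeasurePreserving_fst.ae hG).and (Measure.quasiMeasurePreserving_snd.ae hP)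
  have hMp : IsProbabilityMeasure
      (((gammaMeasure ν 1).prod P).map fun p : ℝ × ℝ ↦ p.1 ^ (1 / β) * p.2) :=
    Measure.isProbabilityMeasure_map hm.aemeasurable
  have hM : ∀ᵐ s ∂(((gammaMeasure ν 1).prod P).map fun p : ℝ × ℝ ↦ p.1 ^ (1 / β) * p.2),
      0 < s := by
    rw [ae_map_iff hm.aemeasurable measurableSet_Ioi]
    filter_upwards [hpos] with p hp
    have := hp.1
    have := hp.2
    positivity
  -- Given `G`, the variable `G ^ (1 / β) * X` has Laplace transform `exp (-u ^ β * G)`; averaging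
  -- over `G` gives `(1 + u ^ β) ^ (-ν)`.
  refine ⟨((gammaMeasure ν 1).prod P).map fun p : ℝ × ℝ ↦ p.1 ^ (1 / β) * p.2, hMp, hM, ?_, ?_⟩
  · intro u hu
    have hint := integrable_exp_neg_mul hM hu.le
    rw [integrable_map_measure (Continuous.aestronglyMeasurable (by fun_prop))
      hm.aemeasurable] at hint
    rw [integral_map hm.aemeasurable (Continuous.aestronglyMeasurable (by fun_prop)),
      integral_prod (fun p : ℝ × ℝ ↦ Real.exp (-(u * (p.1 ^ (1 / β) * p.2)))) hint, ← integral_exp_neg_mul_gammaMeasure hν (by positivity : 0 ≤ u ^ β)]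
    refine integral_congr_ae ?_
    filter_upwards [hG] with e he
    simp only [← mul_assoc]
    rw [hL _ (by positivity), Real.mul_rpow hu.le (by positivity), ← Real.rpow_mul he.le,
      one_div_mul_cancel hβ.ne', Real.rpow_one]
  · intro w hw hwν
    have hβw : 0 < ((β : ℂ) * w).re := by rw [Complex.re_ofReal_mul]; positivity
    have hmc : Measurable fun s : ℝ ↦ (s : ℂ) ^ (-(β * w)) := by fun_prop
    -- The power `-β w` splits as `G ^ (-w) * X ^ (-β w)`, so the moment is a product of a Gamma
    -- moment and a stable one.
    have heq : (fun p : ℝ × ℝ ↦ (p.1 : ℂ) ^ (-w) * (p.2 : ℂ) ^ (-(β * w)))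
        =ᵐ[(gammaMeasure ν 1).prod P]
        fun p ↦ ((p.1 ^ (1 / β) * p.2 : ℝ) : ℂ) ^ (-(β * w)) := by
      filter_upwards [hpos] with p hp
      have h1 : 0 ≤ p.1 ^ (1 / β) := Real.rpow_nonneg hp.1.le _
      rw [Complex.ofReal_mul, Complex.mul_cpow_ofReal_nonneg h1 hp.2.le,
        ← Complex.cpow_mul_ofReal_nonneg hp.1.le]
      congr 2
      have : (β : ℂ) ≠ 0 := by exact_mod_cast hβ.ne'
      push_cast
      field_simp
    constructor
    · rw [integrable_map_measure hmc.aestronglyMeasurable hm.aemeasurable]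
      exact ((integrable_cpow_neg_gammaMeasure hν hwν).mul_prod
        (integrable_cpow_neg_stable hβ hP hL hβw)).congr heq
    · rw [integral_map hm.aemeasurable hmc.aestronglyMeasurable, ← integral_congr_ae heq,
        integral_prod_mul (fun x : ℝ ↦ (x : ℂ) ^ (-w)) (fun x : ℝ ↦ (x : ℂ) ^ (-(β * w))),
        integral_cpow_neg_gammaMeasure hν hwν,
        integral_cpow_neg_stable hβ hP hL hβw, mul_div_cancel_left₀ _ (by exact_mod_cast hβ.ne'),
        div_mul_div_comm, mul_comm (Complex.Gamma w)]

end Moments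

/-! ### Mixtures of heat kernels -/

section GaussianMixture

/-- The radial profile of the heat kernel on `ℝⁿ` at time `s`. -/
noncomputable def heatProfile (n : ℕ) (s r : ℝ) : ℝ :=
  (4 * Real.pi * s) ^ (-((n : ℝ) / 2)) * Real.exp (-(1 / (4 * s)) * r ^ 2)

/-- The radial profile of a mixture of heat kernels on `ℝⁿ` with mixing measure `M`. -/
noncomputable def heatMixture (M : Measure ℝ) (n : ℕ) (r : ℝ) : ℝ :=
  ∫ s, heatProfile n s r ∂M

lemma heatProfile_nonneg (n : ℕ) {s : ℝ} (hs : 0 < s) (r : ℝ) : 0 ≤ heatProfile n s r := by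
  have := Real.pi_pos
  unfold heatProfile; positivity

lemma measurable_heatProfile (n : ℕ) : Measurable fun p : ℝ × ℝ ↦ heatProfile n p.1 p.2 := by
  unfold heatProfile; fun_prop

lemma integral_heatProfile_norm (n : ℕ) {s : ℝ} (hs : 0 < s) :
    ∫ x : EuclideanSpace ℝ (Fin n), heatProfile n s ‖x‖ = 1 := by
  have hpi := Real.pi_pos
  simp only [heatProfile]
  rw [integral_const_mul, GaussianFourier.integral_rexp_neg_mul_sq_norm (by positivity),
    finrank_euclideanSpace_fin, show Real.pi / (1 / (4 * s)) = 4 * Real.pi * s by field_simp,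
    Real.rpow_neg (by positivity), inv_mul_cancel₀ (by positivity)]

lemma integral_cexp_inner_mul_heatProfile (n : ℕ) {s : ℝ} (hs : 0 < s)
    (t : EuclideanSpace ℝ (Fin n)) :
    ∫ x : EuclideanSpace ℝ (Fin n),
      Complex.exp (Complex.I * ((inner ℝ x t : ℝ) : ℂ)) * (heatProfile n s ‖x‖ : ℂ) =
      (Real.exp (-(‖t‖ ^ 2 * s)) : ℂ) := by
  have hpi := Real.pi_pos
  have h := GaussianFourier.integral_cexp_neg_mul_sq_norm_add_of_euclideanSpace
    (b := ((1 / (4 * s) : ℝ) : ℂ)) (by rw [Complex.ofReal_re]; positivity) Complex.I t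
  calc _ = ∫ x : EuclideanSpace ℝ (Fin n), (((4 * Real.pi * s) ^ (-((n : ℝ) / 2)) : ℝ) : ℂ) *
        Complex.exp (-((1 / (4 * s) : ℝ) : ℂ) * ‖x‖ ^ 2 + Complex.I * (inner ℝ t x : ℝ)) := by
        refine integral_congr_ae (ae_of_all _ fun x ↦ ?_)
        simp only [heatProfile]
        rw [Complex.exp_add, real_inner_comm]
        push_cast
        ring
    _ = _ := by
        rw [integral_const_mul, h, ← Complex.ofReal_div,
          show Real.pi / (1 / (4 * s)) = 4 * Real.pi * s by field_simp, Fintype.card_fin,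
          show ((n : ℂ) / 2) = (((n : ℝ) / 2 : ℝ) : ℂ) by push_cast; rfl,
          ← Complex.ofReal_cpow (by positivity), ← mul_assoc, ← Complex.ofReal_mul,
          Real.rpow_neg (by positivity), inv_mul_cancel₀ (by positivity), Complex.ofReal_one,
          one_mul, Complex.I_sq, Complex.ofReal_exp]
        congr 1
        have : (s : ℂ) ≠ 0 := by exact_mod_cast hs.ne'
        push_cast
        field_simp

variable {M : Measure ℝ}

lemma heatMixture_nonneg (n : ℕ) (hM : ∀ᵐ s ∂M, 0 < s) (r : ℝ) : 0 ≤ heatMixture M n r :=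
  integral_nonneg_of_ae <| by
    filter_upwards [hM] with s hs using heatProfile_nonneg n hs r

variable [IsProbabilityMeasure M]

lemma integrable_heatProfile_prod (n : ℕ) (hM : ∀ᵐ s ∂M, 0 < s) :
    Integrable (fun p : EuclideanSpace ℝ (Fin n) × ℝ ↦ heatProfile n p.2 ‖p.1‖)
      (volume.prod M) := by
  have hmeas : Measurable fun p : EuclideanSpace ℝ (Fin n) × ℝ ↦ heatProfile n p.2 ‖p.1‖ :=
    (measurable_heatProfile n).comp (measurable_snd.prodMk measurable_fst.norm)
  rw [integrable_prod_iff' hmeas.aestronglyMeasurable]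
  constructor
  · filter_upwards [hM] with s hs
    exact integrable_of_integral_eq_one (integral_heatProfile_norm n hs)
  · refine (integrable_const (1 : ℝ)).congr ?_
    filter_upwards [hM] with s hs
    simp only [Real.norm_eq_abs, abs_of_nonneg (heatProfile_nonneg n hs _)]
    exact (integral_heatProfile_norm n hs).symm

lemma integrable_heatMixture_norm (n : ℕ) (hM : ∀ᵐ s ∂M, 0 < s) :
    Integrable fun x : EuclideanSpace ℝ (Fin n) ↦ heatMixture M n ‖x‖ :=
  (integrable_heatProfile_prod n hM).integral_prod_left

lemma integral_cexp_inner_mul_heatMixture (n : ℕ) (hM : ∀ᵐ s ∂M, 0 < s)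
    (t : EuclideanSpace ℝ (Fin n)) :
    ∫ x : EuclideanSpace ℝ (Fin n),
      Complex.exp (Complex.I * ((inner ℝ x t : ℝ) : ℂ)) * (heatMixture M n ‖x‖ : ℂ) =
      ((∫ s, Real.exp (-(‖t‖ ^ 2 * s)) ∂M : ℝ) : ℂ) := by
  have hmeas : Measurable fun p : EuclideanSpace ℝ (Fin n) × ℝ ↦ heatProfile n p.2 ‖p.1‖ :=
    (measurable_heatProfile n).comp (measurable_snd.prodMk measurable_fst.norm)
  have hmc : Measurable fun p : EuclideanSpace ℝ (Fin n) × ℝ ↦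
      Complex.exp (Complex.I * ((inner ℝ p.1 t : ℝ) : ℂ)) := by fun_prop
  have hint : Integrable (fun p : EuclideanSpace ℝ (Fin n) × ℝ ↦
      Complex.exp (Complex.I * ((inner ℝ p.1 t : ℝ) : ℂ)) * (heatProfile n p.2 ‖p.1‖ : ℂ))
      (volume.prod M) := by
    refine Integrable.mono (integrable_heatProfile_prod n hM)
      (hmc.mul (Complex.measurable_ofReal.comp hmeas)).aestronglyMeasurable
      (ae_of_all _ fun p ↦ ?_)
    rw [norm_mul, mul_comm Complex.I, Complex.norm_exp_ofReal_mul_I, one_mul, Complex.norm_real]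
  have h := integral_integral_swap (f := fun (x : EuclideanSpace ℝ (Fin n)) (s : ℝ) ↦
      Complex.exp (Complex.I * ((inner ℝ x t : ℝ) : ℂ)) * (heatProfile n s ‖x‖ : ℂ)) hint
  rw [← integral_complex_ofReal]
  calc _ = _ := by
        simp_rw [heatMixture, ← integral_complex_ofReal, ← integral_const_mul]
    _ = _ := h
    _ = _ := by
        refine integral_congr_ae ?_
        filter_upwards [hM] with s hs using integral_cexp_inner_mul_heatProfile n hs t

/-- A bound uniform in `s`: raising `X ≤ exp X` to the power `n / 2`, with `X = r ^ 2 / (2 n s)`,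
makes the powers of `s` cancel. It dominates the mixture away from the origin. -/
lemma heatProfile_le {n : ℕ} (hn : 1 ≤ n) {s δ r : ℝ} (hs : 0 < s) (hδ : 0 < δ) (hr : δ ≤ r) :
    heatProfile n s r ≤ ((n : ℝ) / (2 * Real.pi * δ ^ 2)) ^ ((n : ℝ) / 2) := by
  have hpi := Real.pi_pos
  have hn' : (0 : ℝ) < n := by exact_mod_cast hn
  have hX : 0 < r ^ 2 / (2 * n * s) := by have := hδ.trans_le hr; positivity
  have h1 : (r ^ 2 / (2 * n * s)) ^ ((n : ℝ) / 2) ≤ Real.exp (1 / (4 * s) * r ^ 2) := by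
    calc _ ≤ (Real.exp (r ^ 2 / (2 * n * s))) ^ ((n : ℝ) / 2) := by
          gcongr
          linarith [Real.add_one_le_exp (r ^ 2 / (2 * n * s))]
      _ = _ := by
          rw [← Real.exp_mul]
          congr 1
          field_simp
          ring
  unfold heatProfile
  rw [neg_mul, Real.exp_neg, Real.rpow_neg (by positivity), ← mul_inv]
  calc _ ≤ ((4 * Real.pi * s) ^ ((n : ℝ) / 2) * (r ^ 2 / (2 * n * s)) ^ ((n : ℝ) / 2))⁻¹ := by
        gcongr
    _ = ((n : ℝ) / (2 * Real.pi * r ^ 2)) ^ ((n : ℝ) / 2) := by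
        have := hδ.trans_le hr
        rw [← Real.mul_rpow (by positivity) hX.le, ← Real.inv_rpow (by positivity)]
        congr 1
        field_simp
        ring
    _ ≤ _ := by gcongr

lemma continuousOn_heatMixture {n : ℕ} (hn : 1 ≤ n) (hM : ∀ᵐ s ∂M, 0 < s) :
    ContinuousOn (heatMixture M n) (Ioi 0) := by
  intro r hr
  have hr : (0 : ℝ) < r := hr
  refine ContinuousAt.continuousWithinAt ?_
  refine continuousAt_of_dominated
    (bound := fun _ ↦ ((n : ℝ) / (2 * Real.pi * (r / 2) ^ 2)) ^ ((n : ℝ) / 2)) ?_ ?_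
    (integrable_const _) ?_
  · exact Eventually.of_forall fun r' ↦
      ((measurable_heatProfile n).comp (by fun_prop : Measurable fun s : ℝ ↦ (s, r')))
        |>.aestronglyMeasurable
  · filter_upwards [lt_mem_nhds (half_lt_self hr)] with r' hr'
    filter_upwards [hM] with s hs
    rw [Real.norm_eq_abs, abs_of_nonneg (heatProfile_nonneg n hs _)]
    exact heatProfile_le hn hs (half_pos hr) hr'.le
  · refine ae_of_all _ fun s ↦ ?_
    unfold heatProfile
    fun_prop

end GaussianMixture

/-! ### Existence, uniqueness and radiality of the density -/

section Densities

/-- Integrable nonnegative functions with the same Fourier transform agree almost everywhere. -/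
lemma ae_eq_of_integral_cexp_inner_eq {n : ℕ} {p q : EuclideanSpace ℝ (Fin n) → ℝ}
    (hp : Integrable p) (hq : Integrable q) (hp0 : ∀ x, 0 ≤ p x) (hq0 : ∀ x, 0 ≤ q x)
    (h : ∀ t : EuclideanSpace ℝ (Fin n),
      ∫ x, Complex.exp (Complex.I * ((inner ℝ x t : ℝ) : ℂ)) * ((p x : ℝ) : ℂ) =
        ∫ x, Complex.exp (Complex.I * ((inner ℝ x t : ℝ) : ℂ)) * ((q x : ℝ) : ℂ)) :
    p =ᵐ[volume] q := by
  have hfin {f : EuclideanSpace ℝ (Fin n) → ℝ} (hf : Integrable f) :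
      IsFiniteMeasure (volume.withDensity fun x ↦ ENNReal.ofReal (f x)) :=
    isFiniteMeasure_withDensity_ofReal hf.2
  have hchar {f : EuclideanSpace ℝ (Fin n) → ℝ} (hf : Integrable f) (hf0 : ∀ x, 0 ≤ f x)
      (t : EuclideanSpace ℝ (Fin n)) :
      charFun (volume.withDensity fun x ↦ ENNReal.ofReal (f x)) t =
        ∫ x, Complex.exp (Complex.I * ((inner ℝ x t : ℝ) : ℂ)) * ((f x : ℝ) : ℂ) := by
    rw [charFun_apply, integral_withDensity_eq_integral_toReal_smul₀
      hf.aestronglyMeasurable.aemeasurable.ennreal_ofReal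
      (ae_of_all _ fun x ↦ ENNReal.ofReal_lt_top)]
    refine integral_congr_ae (ae_of_all _ fun x ↦ ?_)
    simp only [ENNReal.toReal_ofReal (hf0 x), Complex.real_smul]
    rw [mul_comm, mul_comm Complex.I]
  have := hfin hp
  have := hfin hq
  have heq : (volume.withDensity fun x ↦ ENNReal.ofReal (p x)) =
      volume.withDensity fun x ↦ ENNReal.ofReal (q x) :=
    Measure.ext_of_charFun (funext fun t ↦ by rw [hchar hp hp0, hchar hq hq0, h])
  have := measure_ne_top (volume.withDensity fun x ↦ ENNReal.ofReal (p x)) univ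
  rw [withDensity_eq_iff hp.aestronglyMeasurable.aemeasurable.ennreal_ofReal
    hq.aestronglyMeasurable.aemeasurable.ennreal_ofReal
    (by simpa [withDensity_apply] using! this)] at heq
  filter_upwards [heq] with x hx
  exact (ENNReal.ofReal_eq_ofReal_iff (hp0 x) (hq0 x)).1 hx

/-- Functions that agree almost everywhere and are continuous on an open set agree at each of its
points. -/
lemma IsLinnikDensity.eq_of_ne_zero {α ν : ℝ} {n : ℕ} {p q : EuclideanSpace ℝ (Fin n) → ℝ}
    (hp : IsLinnikDensity α ν n p) (hq : IsLinnikDensity α ν n q)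
    {x : EuclideanSpace ℝ (Fin n)} (hx : x ≠ 0) : p x = q x :=
  Measure.eqOn_open_of_ae_eq (μ := volume) (U := {0}ᶜ)
    (ae_restrict_of_ae (ae_eq_of_integral_cexp_inner_eq hp.integrable hq.integrable hp.nonneg
      hq.nonneg fun t ↦ by rw [hp.fourier, hq.fourier]))
    isOpen_compl_singleton hp.continuousOn hq.continuousOn hx

lemma isLinnikDensity_heatMixture {β ν : ℝ} (hβ : 0 < β) {n : ℕ} (hn : 1 ≤ n)
    {M : Measure ℝ} [IsProbabilityMeasure M] (hM : ∀ᵐ s ∂M, 0 < s)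
    (hL : ∀ u : ℝ, 0 < u → ∫ s, Real.exp (-(u * s)) ∂M = 1 / (1 + u ^ β) ^ ν) :
    IsLinnikDensity (2 * β) ν n fun x ↦ heatMixture M n ‖x‖ where
  nonneg x := heatMixture_nonneg n hM _
  integrable := integrable_heatMixture_norm n hM
  fourier t := by
    rw [integral_cexp_inner_mul_heatMixture n hM t]
    congr 1
    -- The Laplace formula is available only for `u > 0`; at `t = 0` both sides are `1`.
    rcases eq_or_ne t 0 with rfl | ht
    · simp [linnikCharFun, Real.zero_rpow (mul_pos two_pos hβ).ne']
    · have ht' : 0 < ‖t‖ := norm_pos_iff.2 ht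
      rw [hL _ (by positivity), linnikCharFun, Real.rpow_mul ht'.le, Real.rpow_two]
  continuousOn := (continuousOn_heatMixture hn hM).comp continuous_norm.continuousOn
    fun _ hx ↦ norm_pos_iff.2 hx

end Densities

/-! ### Mellin transform of the mixture -/

section MellinHeat

/-- The substitution of `r ^ 2` for `r` turns the Gaussian integral into a Gamma integral at `z /
2`. -/
lemma mellin_heatProfile (n : ℕ) {s : ℝ} (hs : 0 < s) {z : ℂ} (hz : 0 < z.re) :
    mellin (fun r ↦ (heatProfile n s r : ℂ)) z =
      (Real.pi : ℂ) ^ (-(n / 2 : ℂ)) / 2 * Complex.Gamma (z / 2) * 4 ^ ((z - n) / 2) *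
        (s : ℂ) ^ ((z - n) / 2) := by
  have hpi := Real.pi_pos
  have hb : 0 < 1 / (4 * s) := by positivity
  have hs' : (s : ℂ) ≠ 0 := by exact_mod_cast hs.ne'
  have h1 : mellin (fun u : ℝ ↦ Complex.exp (-(((1 / (4 * s) : ℝ) : ℂ) * u))) (z / 2) =
      (4 * s : ℂ) ^ (z / 2) * Complex.Gamma (z / 2) := by
    have := Complex.integral_cpow_mul_exp_neg_mul_Ioi (a := z / 2) (by simpa using hz) hb
    rw [mellin]
    simp only [smul_eq_mul]
    rw [this]
    congr 2
    push_cast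
    field_simp
  have h2 := mellin_comp_rpow (fun u : ℝ ↦ Complex.exp (-(((1 / (4 * s) : ℝ) : ℂ) * u))) z 2
  rw [show z / ((2 : ℝ) : ℂ) = z / 2 by norm_num, h1] at h2
  have h3 : (fun r ↦ (heatProfile n s r : ℂ)) = fun r : ℝ ↦
      ((4 * Real.pi * s : ℝ) : ℂ) ^ (-(n / 2 : ℂ)) •
        Complex.exp (-(((1 / (4 * s) : ℝ) : ℂ) * ((r ^ (2 : ℝ) : ℝ) : ℂ))) := by
    ext r
    rw [heatProfile, Complex.ofReal_mul, Complex.ofReal_cpow (by positivity), Real.rpow_two]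
    push_cast
    rw [smul_eq_mul, neg_mul]
  rw [h3, mellin_const_smul, h2, Complex.real_smul, smul_eq_mul, abs_of_pos two_pos]
  have h4 (e : ℂ) : (4 * s : ℂ) ^ e = 4 ^ e * (s : ℂ) ^ e := by
    have := Complex.mul_cpow_ofReal_nonneg (a := 4) (by norm_num) hs.le e
    push_cast at this
    exact this
  have h5 (e : ℂ) : ((4 * Real.pi * s : ℝ) : ℂ) ^ e = (Real.pi : ℂ) ^ e * (4 ^ e * (s : ℂ) ^ e) := by
    rw [← h4, show 4 * Real.pi * s = Real.pi * (4 * s) by ring, Complex.ofReal_mul,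
      Complex.mul_cpow_ofReal_nonneg hpi.le (by positivity)]
    push_cast
    rfl
  rw [h5, h4, show (z - n) / 2 = -(n / 2 : ℂ) + z / 2 by ring,
    Complex.cpow_add _ _ (by norm_num), Complex.cpow_add _ _ hs']
  push_cast
  ring

lemma mellinConvergent_heatProfile (n : ℕ) {s : ℝ} (hs : 0 < s) {z : ℂ} (hz : 0 < z.re) :
    MellinConvergent (fun r ↦ (heatProfile n s r : ℂ)) z := by
  refine Integrable.of_integral_ne_zero ?_
  have h := mellin_heatProfile n hs hz
  rw [mellin] at h
  rw [h]
  have hs' : (s : ℂ) ≠ 0 := by exact_mod_cast hs.ne'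
  have hpi : (Real.pi : ℂ) ≠ 0 := by exact_mod_cast Real.pi_pos.ne'
  have hΓ : Complex.Gamma (z / 2) ≠ 0 := Complex.Gamma_ne_zero_of_re_pos (by simpa using hz)
  simp [Complex.cpow_eq_zero_iff, hs', hpi, hΓ]

variable {M : Measure ℝ} [IsProbabilityMeasure M]

lemma integrable_cpow_mul_heatProfile_prod (n : ℕ) (hM : ∀ᵐ s ∂M, 0 < s) {z : ℂ} (hz : 0 < z.re)
    (hint : Integrable (fun s : ℝ ↦ (s : ℂ) ^ ((z - n) / 2)) M) :
    Integrable (fun p : ℝ × ℝ ↦ (p.1 : ℂ) ^ (z - 1) * (heatProfile n p.2 p.1 : ℂ))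
      ((volume.restrict (Ioi 0)).prod M) := by
  have hmeas : Measurable fun p : ℝ × ℝ ↦ heatProfile n p.2 p.1 :=
    (measurable_heatProfile n).comp measurable_swap
  have hmc : Measurable fun p : ℝ × ℝ ↦ (p.1 : ℂ) ^ (z - 1) := by fun_prop
  have hmp : Measurable fun p : ℝ × ℝ ↦ (p.1 : ℂ) ^ (z - 1) * (heatProfile n p.2 p.1 : ℂ) :=
    hmc.mul (Complex.measurable_ofReal.comp hmeas)
  rw [integrable_prod_iff' hmp.aestronglyMeasurable]
  constructor
  · filter_upwards [hM] with s hs using mellinConvergent_heatProfile n hs hz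
  -- The profile is nonnegative, so the integral of the norm is the Mellin transform at the real
  -- point `z.re`.
  · set σ : ℂ := ((z.re : ℝ) : ℂ) with hσ
    have hσ0 : 0 < σ.re := by simpa [hσ] using hz
    refine (hint.norm.const_mul ‖(Real.pi : ℂ) ^ (-(n / 2 : ℂ)) / 2 * Complex.Gamma (σ / 2) *
      4 ^ ((σ - n) / 2)‖).congr ?_
    filter_upwards [hM] with s hs
    have hre : ‖(s : ℂ) ^ ((z - n) / 2)‖ = ‖(s : ℂ) ^ ((σ - n) / 2)‖ := by
      rw [Complex.norm_cpow_eq_rpow_re_of_pos hs, Complex.norm_cpow_eq_rpow_re_of_pos hs]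
      simp [hσ]
    rw [hre, ← norm_mul, ← mellin_heatProfile n hs hσ0]
    have hnn : 0 ≤ ∫ r in Ioi (0 : ℝ), ‖(r : ℂ) ^ (z - 1) * (heatProfile n s r : ℂ)‖ :=
      integral_nonneg fun _ ↦ norm_nonneg _
    rw [← abs_of_nonneg hnn, ← Real.norm_eq_abs, ← Complex.norm_real, ← integral_complex_ofReal,
      mellin]
    congr 1
    refine setIntegral_congr_fun measurableSet_Ioi fun r hr ↦ ?_
    have hr : (0 : ℝ) < r := hr
    simp only [norm_mul, smul_eq_mul, Complex.norm_real, Real.norm_eq_abs,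
      abs_of_nonneg (heatProfile_nonneg n hs r)]
    rw [Complex.norm_cpow_eq_rpow_re_of_pos hr, Complex.ofReal_mul, Complex.ofReal_cpow hr.le]
    simp [hσ]

lemma mellinConvergent_heatMixture (n : ℕ) (hM : ∀ᵐ s ∂M, 0 < s) {z : ℂ} (hz : 0 < z.re)
    (hint : Integrable (fun s : ℝ ↦ (s : ℂ) ^ ((z - n) / 2)) M) :
    MellinConvergent (fun r ↦ (heatMixture M n r : ℂ)) z := by
  refine (integrable_cpow_mul_heatProfile_prod n hM hz hint).integral_prod_left.congr ?_
  refine ae_of_all _ fun r ↦ ?_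
  simp only [smul_eq_mul, heatMixture]
  rw [integral_const_mul, integral_complex_ofReal]

lemma mellin_heatMixture (n : ℕ) (hM : ∀ᵐ s ∂M, 0 < s) {z : ℂ} (hz : 0 < z.re)
    (hint : Integrable (fun s : ℝ ↦ (s : ℂ) ^ ((z - n) / 2)) M) :
    mellin (fun r ↦ (heatMixture M n r : ℂ)) z =
      (Real.pi : ℂ) ^ (-(n / 2 : ℂ)) / 2 * Complex.Gamma (z / 2) * 4 ^ ((z - n) / 2) *
        ∫ s : ℝ, (s : ℂ) ^ ((z - n) / 2) ∂M := by
  have h := integral_integral_swap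
    (f := fun r s : ℝ ↦ (r : ℂ) ^ (z - 1) * (heatProfile n s r : ℂ))
    (integrable_cpow_mul_heatProfile_prod n hM hz hint)
  rw [mellin, ← integral_const_mul]
  calc _ = _ := by
        simp_rw [smul_eq_mul, heatMixture, ← integral_complex_ofReal, ← integral_const_mul]
    _ = _ := h
    _ = _ := by
        refine integral_congr_ae ?_
        filter_upwards [hM] with s hs using mellin_heatProfile n hs hz

lemma measurable_mellin_heatMixture (n : ℕ) (σ : ℝ) :
    AEStronglyMeasurable fun y : ℝ ↦
      mellin (fun r ↦ (heatMixture M n r : ℂ)) (σ + y * Complex.I) := by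
  have h1 : Measurable (heatMixture M n) :=
    (StronglyMeasurable.integral_prod_right (f := fun r s ↦ heatProfile n s r)
      ((measurable_heatProfile n).comp measurable_swap).stronglyMeasurable).measurable
  have h2 : Measurable fun p : ℝ × ℝ ↦
      (p.2 : ℂ) ^ ((σ : ℂ) + p.1 * Complex.I - 1) • (heatMixture M n p.2 : ℂ) := by fun_prop
  exact (StronglyMeasurable.integral_prod_right (ν := volume.restrict (Ioi (0 : ℝ)))
    (f := fun y r : ℝ ↦ (r : ℂ) ^ ((σ : ℂ) + y * Complex.I - 1) • (heatMixture M n r : ℂ))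
    h2.stronglyMeasurable).aestronglyMeasurable

end MellinHeat

/-! ### Decay of the Gamma function on vertical lines -/

section GammaLine

lemma Complex.norm_Gamma_le_Gamma_re {z : ℂ} (hz : 0 < z.re) :
    ‖Complex.Gamma z‖ ≤ Real.Gamma z.re := by
  rw [Complex.Gamma_eq_integral hz, Real.Gamma_eq_integral hz, Complex.GammaIntegral]
  refine (norm_integral_le_integral_norm _).trans_eq ?_
  refine setIntegral_congr_fun measurableSet_Ioi fun x hx ↦ ?_
  have hx : (0 : ℝ) < x := hx
  simp only [norm_mul, Complex.norm_cpow_eq_rpow_re_of_pos hx, Complex.norm_real,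
    Real.norm_eq_abs, Real.abs_exp, Complex.sub_re, Complex.one_re]

/-- Quadratic decay suffices, and Stirling's formula is not needed: `(z + 1) * z * Γ(z) = Γ(z + 2)`
is bounded by `Γ(σ + 2)` on the line. -/
lemma verticalIntegrable_Gamma {σ : ℝ} (hσ : 0 < σ) :
    Complex.VerticalIntegrable Complex.Gamma σ := by
  have hre (y : ℝ) : ((σ : ℂ) + y * Complex.I).re = σ := by simp
  have hcont : Continuous fun y : ℝ ↦ Complex.Gamma (σ + y * Complex.I) := by
    refine continuous_iff_continuousAt.2 fun y ↦ ?_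
    have h1 : ContinuousAt Complex.Gamma ((σ : ℂ) + y * Complex.I) :=
      (Complex.differentiableAt_Gamma _ fun m hm ↦ by
        have := congrArg Complex.re hm
        rw [hre] at this
        simp at this
        have : (0 : ℝ) ≤ m := by positivity
        linarith).continuousAt
    exact h1.comp (f := fun y : ℝ ↦ (σ : ℂ) + y * Complex.I) (by fun_prop)
  have hm : 0 < min (σ ^ 2) 1 := by positivity
  refine Integrable.mono' ((integrable_inv_one_add_sq).const_mul
    (Real.Gamma (σ + 2) * (min (σ ^ 2) 1)⁻¹)) hcont.aestronglyMeasurable (ae_of_all _ fun y ↦ ?_)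
  set z : ℂ := σ + y * Complex.I with hz
  have hzre : z.re = σ := hre y
  have hz0 : z ≠ 0 := fun h ↦ by rw [h] at hzre; simp at hzre; linarith
  have hz1 : z + 1 ≠ 0 := fun h ↦ by
    have := congrArg Complex.re h
    simp [hzre] at this
    linarith
  have hG : Complex.Gamma (z + 2) = (z + 1) * (z * Complex.Gamma z) := by
    rw [show z + 2 = z + 1 + 1 by ring, Complex.Gamma_add_one _ hz1, Complex.Gamma_add_one _ hz0]
  have hle := Complex.norm_Gamma_le_Gamma_re (z := z + 2) (by simp [hzre]; linarith)
  rw [hG, norm_mul, norm_mul, ← mul_assoc] at hle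
  simp only [Complex.add_re, hzre, Complex.re_ofNat] at hle
  have hsq : ‖z‖ ^ 2 = σ ^ 2 + y ^ 2 := by
    rw [← Complex.normSq_eq_norm_sq, Complex.normSq_apply]
    simp [hz]
    ring
  have hsq1 : ‖z + 1‖ ^ 2 = (σ + 1) ^ 2 + y ^ 2 := by
    rw [← Complex.normSq_eq_norm_sq, Complex.normSq_apply]
    simp [hz]
    ring
  have hge : ‖z‖ ≤ ‖z + 1‖ := by
    refine le_of_sq_le_sq ?_ (norm_nonneg _)
    rw [hsq, hsq1]; nlinarith
  have hlow : min (σ ^ 2) 1 * (1 + y ^ 2) ≤ ‖z + 1‖ * ‖z‖ := by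
    calc _ ≤ σ ^ 2 + y ^ 2 := by
          nlinarith [min_le_left (σ ^ 2) 1, min_le_right (σ ^ 2) 1, sq_nonneg y]
      _ = ‖z‖ * ‖z‖ := by rw [← hsq, sq]
      _ ≤ _ := by gcongr
  have hfin : min (σ ^ 2) 1 * (1 + y ^ 2) * ‖Complex.Gamma z‖ ≤ Real.Gamma (σ + 2) :=
    (mul_le_mul_of_nonneg_right hlow (norm_nonneg _)).trans hle
  rw [mul_assoc, ← mul_inv, ← div_eq_mul_inv, le_div_iff₀ (by positivity), mul_comm]
  exact hfin

end GammaLine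

/-! ### Mellin inversion -/

section Inversion

variable {M : Measure ℝ} [IsProbabilityMeasure M]

/-- On the line the powers of `4` and `s` have constant modulus, so the decay of `Γ(z / 2)` controls
the whole transform. -/
lemma verticalIntegrable_mellin_heatMixture (n : ℕ) (hM : ∀ᵐ s ∂M, 0 < s) {σ : ℝ} (hσ : 0 < σ)
    (hint : Integrable (fun s : ℝ ↦ (s : ℂ) ^ (((σ : ℂ) - n) / 2)) M) :
    Complex.VerticalIntegrable (mellin fun r ↦ (heatMixture M n r : ℂ)) σ := by
  have hσz (y : ℝ) : 0 < ((σ : ℂ) + y * Complex.I).re := by simpa using hσ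
  have hnorm (y : ℝ) {s : ℝ} (hs : 0 < s) :
      ‖(s : ℂ) ^ (((σ : ℂ) + y * Complex.I - n) / 2)‖ = ‖(s : ℂ) ^ (((σ : ℂ) - n) / 2)‖ := by
    rw [Complex.norm_cpow_eq_rpow_re_of_pos hs, Complex.norm_cpow_eq_rpow_re_of_pos hs]
    simp
  have hint' (y : ℝ) :
      Integrable (fun s : ℝ ↦ (s : ℂ) ^ (((σ : ℂ) + y * Complex.I - n) / 2)) M := by
    refine hint.mono (Measurable.aestronglyMeasurable (by fun_prop)) ?_
    filter_upwards [hM] with s hs using (hnorm y hs).le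
  have hΓ : Integrable fun y : ℝ ↦ Complex.Gamma (((σ : ℂ) + y * Complex.I) / 2) := by
    have := (verticalIntegrable_Gamma (half_pos hσ)).comp_mul_right' (R := 1 / 2) (by norm_num)
    refine this.congr (ae_of_all _ fun y ↦ ?_)
    simp only
    congr 1
    push_cast
    ring
  refine Integrable.mono' (hΓ.norm.const_mul (‖(Real.pi : ℂ) ^ (-(n / 2 : ℂ)) / 2‖ *
      ‖(4 : ℂ) ^ (((σ : ℂ) - n) / 2)‖ * ∫ s : ℝ, ‖(s : ℂ) ^ (((σ : ℂ) - n) / 2)‖ ∂M))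
    (measurable_mellin_heatMixture n σ) (ae_of_all _ fun y ↦ ?_)
  rw [mellin_heatMixture n hM (hσz y) (hint' y), norm_mul, norm_mul, norm_mul]
  have h4 : ‖(4 : ℂ) ^ (((σ : ℂ) + y * Complex.I - n) / 2)‖ =
      ‖(4 : ℂ) ^ (((σ : ℂ) - n) / 2)‖ := by
    simpa using hnorm y (s := 4) (by norm_num)
  have hI : ‖∫ s : ℝ, (s : ℂ) ^ (((σ : ℂ) + y * Complex.I - n) / 2) ∂M‖ ≤
      ∫ s : ℝ, ‖(s : ℂ) ^ (((σ : ℂ) - n) / 2)‖ ∂M := by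
    refine (norm_integral_le_integral_norm _).trans_eq (integral_congr_ae ?_)
    filter_upwards [hM] with s hs using hnorm y hs
  rw [h4]
  calc _ ≤ ‖(Real.pi : ℂ) ^ (-(n / 2 : ℂ)) / 2‖ *
        ‖Complex.Gamma (((σ : ℂ) + y * Complex.I) / 2)‖ * ‖(4 : ℂ) ^ (((σ : ℂ) - n) / 2)‖ *
        ∫ s : ℝ, ‖(s : ℂ) ^ (((σ : ℂ) - n) / 2)‖ ∂M := by gcongr
    _ = _ := by ring

/-- The substitution `z = n - 2 β w`, with `r ^ (2 β w) * 4 ^ (-β w) = (r / 2) ^ (2 β w)`. The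
leftover `1 / (2 β)` is cancelled later by the Jacobian. -/
lemma cpow_mul_mellin_eq_linnikKernel {β ν : ℝ} {n : ℕ} (hβ : 0 < β) (hν : 0 < ν)
    (hM : ∀ᵐ s ∂M, 0 < s) {w : ℂ} (hn : 2 * β * w.re < n)
    (hint : Integrable (fun s : ℝ ↦ (s : ℂ) ^ (-(β * w))) M)
    (hmom : ∫ s : ℝ, (s : ℂ) ^ (-(β * w)) ∂M = Complex.Gamma w * Complex.Gamma (ν - w) /
      (Complex.Gamma ν * (β * Complex.Gamma (β * w)))) {r : ℝ} (hr : 0 < r) :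
    (r : ℂ) ^ (-(n - 2 * β * w : ℂ)) *
        mellin (fun r ↦ (heatMixture M n r : ℂ)) (n - 2 * β * w) =
      ((r ^ (-(n : ℝ)) / (Real.pi ^ ((n : ℝ) / 2) * Real.Gamma ν) : ℝ) : ℂ) / (2 * β) *
        linnikKernel (2 * β) ν n r w := by
  have hpi := Real.pi_pos
  have hr' : (r : ℂ) ≠ 0 := by exact_mod_cast hr.ne'
  have hβ' : (β : ℂ) ≠ 0 := by exact_mod_cast hβ.ne'
  have hz : 0 < ((n : ℂ) - 2 * β * w).re := by
    have : ((n : ℂ) - 2 * β * w).re = n - 2 * β * w.re := by simp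
    rw [this]; linarith
  have he : ((n : ℂ) - 2 * β * w - n) / 2 = -(β * w) := by ring
  rw [mellin_heatMixture n hM hz (by rwa [he]), he, hmom, linnikKernel]
  have h4 : (4 : ℂ) ^ (-(β * w)) = ((2 : ℂ) ^ (2 * β * w))⁻¹ := by
    have := Complex.mul_cpow_ofReal_nonneg (a := 2) (b := 2) (by norm_num) (by norm_num) (β * w)
    norm_num at this
    rw [Complex.cpow_neg, this, ← Complex.cpow_add _ _ two_ne_zero]
    ring_nf
  have h2 : (r : ℂ) ^ (2 * β * w) = ((r / 2 : ℝ) : ℂ) ^ (2 * β * w) * 2 ^ (2 * β * w) := by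
    have := Complex.mul_cpow_ofReal_nonneg (a := r / 2) (b := 2) (by positivity) (by norm_num)
      (2 * β * w)
    rw [← Complex.ofReal_mul, div_mul_cancel₀ _ two_ne_zero] at this
    exact this
  have h2' : (2 : ℂ) ^ (2 * β * w) ≠ 0 := by simp [Complex.cpow_eq_zero_iff]
  have hπ : (Real.pi : ℂ) ^ (n / 2 : ℂ) ≠ 0 := by
    simp [Complex.cpow_eq_zero_iff, hpi.ne']
  have hΓν : Complex.Gamma ν ≠ 0 := Complex.Gamma_ne_zero_of_re_pos (by simpa using hν)
  rw [h4, show -((n : ℂ) - 2 * β * w) = -n + 2 * β * w by ring, Complex.cpow_add _ _ hr', h2,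
    Complex.cpow_neg _ (n / 2 : ℂ)]
  push_cast [Complex.ofReal_cpow hr.le, Complex.ofReal_cpow hpi.le]
  rw [← Complex.Gamma_ofReal, show 2 * (β : ℂ) * w / 2 = β * w by ring]
  field_simp

/-- The mixture of heat kernels as a contour integral along `Re w = c`. -/
lemma heatMixture_eq_verticalLineIntegral {β ν : ℝ} {n : ℕ} (hβ : 0 < β) (hν : 0 < ν) (hn : 1 ≤ n)
    (hM : ∀ᵐ s ∂M, 0 < s)
    (hmom : ∀ w : ℂ, 0 < w.re → w.re < ν →
      Integrable (fun s : ℝ ↦ (s : ℂ) ^ (-(β * w))) M ∧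
      ∫ s : ℝ, (s : ℂ) ^ (-(β * w)) ∂M = Complex.Gamma w * Complex.Gamma (ν - w) /
        (Complex.Gamma ν * (β * Complex.Gamma (β * w))))
    {r c : ℝ} (hr : 0 < r) (hc : 0 < c) (hcν : c < ν) (hcn : 2 * β * c < n) :
    Complex.VerticalIntegrable (linnikKernel (2 * β) ν n r) c volume ∧
      (heatMixture M n r : ℂ) =
        ((r ^ (-(n : ℝ)) / (Real.pi ^ ((n : ℝ) / 2) * Real.Gamma ν) : ℝ) : ℂ) *
          (1 / (2 * (Real.pi : ℂ) * Complex.I) *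
            verticalLineIntegral (linnikKernel (2 * β) ν n r) c) := by
  have hpi := Real.pi_pos
  have hΓν := Real.Gamma_pos_of_pos hν
  set A : ℂ := ((r ^ (-(n : ℝ)) / (Real.pi ^ ((n : ℝ) / 2) * Real.Gamma ν) : ℝ) : ℂ) with hA
  have hA0 : A ≠ 0 := by
    rw [hA]
    exact_mod_cast (by positivity :
      0 < r ^ (-(n : ℝ)) / (Real.pi ^ ((n : ℝ) / 2) * Real.Gamma ν)).ne'
  have hβ' : (β : ℂ) ≠ 0 := by exact_mod_cast hβ.ne'
  set σ : ℝ := n - 2 * β * c with hσ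
  have hσ0 : 0 < σ := by linarith
  set F : ℂ → ℂ := mellin fun r ↦ (heatMixture M n r : ℂ) with hF
  have hintσ : Integrable (fun s : ℝ ↦ (s : ℂ) ^ (((σ : ℂ) - n) / 2)) M := by
    have := (hmom c (by simpa using hc) (by simpa using hcν)).1
    rwa [show -((β : ℂ) * c) = ((σ : ℂ) - n) / 2 by rw [hσ]; push_cast; ring] at this
  have hFv : Complex.VerticalIntegrable F σ :=
    verticalIntegrable_mellin_heatMixture n hM hσ0 hintσ
  set H : ℝ → ℂ := fun y ↦ (r : ℂ) ^ (-((σ : ℂ) + y * Complex.I)) * F (σ + y * Complex.I) with hH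
  have hHint : Integrable H := by
    refine (Integrable.norm hFv).const_mul (r ^ (-σ)) |>.mono'
      ((Measurable.aestronglyMeasurable (by fun_prop)).mul hFv.aestronglyMeasurable)
      (ae_of_all _ fun y ↦ ?_)
    rw [hH, norm_mul, Complex.norm_cpow_eq_rpow_re_of_pos hr]
    simp
  -- The height `y` on `Re w = c` corresponds to the height `-2 β y` on `Re z = σ`.
  have hker (y : ℝ) : linnikKernel (2 * β) ν n r (c + y * Complex.I) =
      2 * β / A * H (-(2 * β) * y) := by
    have hre : ((c : ℂ) + y * Complex.I).re = c := by simp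
    obtain ⟨h1, h2⟩ := hmom (c + y * Complex.I) (by rwa [hre]) (by rwa [hre])
    have h := cpow_mul_mellin_eq_linnikKernel hβ hν hM (by rwa [hre]) h1 h2 hr
    have hz : (σ : ℂ) + ((-(2 * β) * y : ℝ) : ℂ) * Complex.I =
        n - 2 * β * (c + y * Complex.I) := by
      rw [hσ]; push_cast; ring
    simp only [hH]
    rw [hz, h, ← hA]
    field_simp
  constructor
  · have := (hHint.comp_mul_left' (R := -(2 * β)) (by linarith)).const_mul (2 * β / A)
    exact this.congr (ae_of_all _ fun y ↦ (hker y).symm)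
  · have hcont : ContinuousAt (fun r ↦ (heatMixture M n r : ℂ)) r :=
      Complex.continuous_ofReal.continuousAt.comp
        ((continuousOn_heatMixture hn hM).continuousAt (Ioi_mem_nhds hr))
    have hconv : MellinConvergent (fun r ↦ (heatMixture M n r : ℂ)) σ :=
      mellinConvergent_heatMixture n hM (by simpa using hσ0) hintσ
    have hinv := mellinInv_mellin_eq σ (fun r ↦ (heatMixture M n r : ℂ)) hr hconv hFv hcont
    rw [← hinv, mellinInv, verticalLineIntegral, integral_mul_const]
    simp_rw [hker]
    rw [integral_const_mul, Measure.integral_comp_mul_left, ← hF]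
    simp only [smul_eq_mul, Complex.real_smul]
    -- The reversed direction is harmless, as only the absolute value `2 β` of the scaling factor
    -- enters.
    rw [abs_inv, abs_neg, abs_of_pos (by positivity : 0 < 2 * β)]
    push_cast
    have hpi' : (Real.pi : ℂ) ≠ 0 := by exact_mod_cast hpi.ne'
    field_simp [Complex.I_ne_zero]
    rfl

end Inversion

end LinnikTheory

/-! ### The main theorem -/

theorem mainTheorem2 (α ν : ℝ) (n : ℕ) (hα : 0 < α) (hα2 : α < 2) (hν : 0 < ν) (hn : 1 ≤ n) :
    (∃ p : EuclideanSpace ℝ (Fin n) → ℝ, IsLinnikDensity α ν n p) ∧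
    ∀ p : EuclideanSpace ℝ (Fin n) → ℝ, IsLinnikDensity α ν n p →
      ∃ q : ℝ → ℝ, (∀ x : EuclideanSpace ℝ (Fin n), x ≠ 0 → p x = q ‖x‖) ∧
        ∀ r : ℝ, 0 < r → ∀ c : ℝ, 0 < c → c < min ν (1 / α) →
          Complex.VerticalIntegrable (linnikKernel α ν n r) c MeasureTheory.volume ∧
          ((q r : ℝ) : ℂ) =
            ((r ^ (-(n : ℝ)) / (Real.pi ^ ((n : ℝ) / 2) * Real.Gamma ν) : ℝ) : ℂ) *
              (1 / (2 * (Real.pi : ℂ) * Complex.I) *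
                verticalLineIntegral (linnikKernel α ν n r) c) := by
  obtain ⟨β, rfl⟩ : ∃ β, α = 2 * β := ⟨α / 2, by ring⟩
  have hβ : 0 < β := by linarith
  obtain ⟨M, _, hM, hL, hmom⟩ := exists_linnik_mixing hβ (by linarith) hν
  have hdens := isLinnikDensity_heatMixture hβ hn hM hL
  refine ⟨⟨_, hdens⟩, fun p hp ↦ ⟨heatMixture M n, fun x hx ↦ hp.eq_of_ne_zero hdens hx,
    fun r hr c hc hcmin ↦ ?_⟩⟩
  obtain ⟨hcν, hcα⟩ := lt_min_iff.1 hcmin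
  -- From `c < 1 / α` follows `α c < 1 ≤ n`, so the Mellin line `Re z = n - α c` lies in the right
  -- half-plane.
  rw [lt_div_iff₀ hα, mul_comm] at hcα
  have hn' : (1 : ℝ) ≤ n := by exact_mod_cast hn
  exact heatMixture_eq_verticalLineIntegral hβ hν hn hM hmom hr hc hcν (hcα.trans_le hn')
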